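/- Identify the space $\mathcal L$ of oriented lines in $\mathbb R^3$ with $\{(v,x)\in S^2\times\mathbb R^3 : x\cdot v=0\}$, where $v$ is the unit direction of the line and $x$ is its point nearest to the origin, with the metric induced from $\mathbb R^3\times\mathbb R^3$. Let $\mathcal C\subset\mathcal L^2$ be the space of pairs of disjoint oriented lines (the configuration space of the linkage $\Gamma_1$ consisting of two oriented lines). For $c,c'\in\mathcal C$ let $\delta'(c,c')$ be the infimum of the lengths, measured in $\mathcal L^2\subset(\mathbb R^3\times\mathbb R^3)^2$, of the rectifiable paths from $c$ to $c'$ inside $\mathcal C$ ($\infty$ if there are none), and let $d_{\mathrm{path}}=\min\{\delta',1\}$. Let $\widehat{\mathcal C}$ be the completion of $\mathcal C$ with respect to the metric $d_{\mathrm{path}}$ (the completed configuration space). For disjoint oriented lines $\ell,\ell'$ with directions $v,v'$ put $\phi(\ell,\ell')=0\in\mathbb Z/3=\{-1,0,1\}$ if they are coplanar, and otherwise $\phi(\ell,\ell')=\operatorname{sgn}(w\cdot(v\times v'))$, where $w=b-a$ for the points $a\in\ell$, $b\in\ell'$ at minimal distance from each other. Let $\mathcal P=\{(1,2),(2,1)\}$,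 let $\mathcal F=\mathcal L^2\times(\mathbb Z/3)^{\mathcal P}$ (with $\mathbb Z/3$ discrete), and for $c=(\ell_1,\ell_2)\in\mathcal C$ let $\phi(c)=(\phi(\ell_i,\ell_j))_{(i,j)\in\mathcal P}$ and $\Phi(c)=(c,\phi(c))\in\mathcal F$. Let $\sim$ be the equivalence relation on $\mathcal F$ generated by: $(x,\alpha)\sim(x,\beta)$ whenever there is a $d_{\mathrm{path}}$-Cauchy sequence $(c_i)$ in $\mathcal C$ that converges to $x$ in $\mathcal L^2$ and satisfies $\phi(c_i)=\alpha$ for infinitely many $i$ and $\phi(c_i)=\beta$ for infinitely many $i$. Let $\widetilde{\mathcal F}=\mathcal F/{\sim}$ with the quotient topology, and let $\widetilde\Phi:\widehat{\mathcal C}\to\widetilde{\mathcal F}$ be the map induced by $\Phi$: if $p\in\widehat{\mathcal C}$ is represented by a Cauchy sequence $(c_i)$ in $\mathcal C$ with limit $x$ in $\mathcal L^2$, then $\widetilde\Phi(p)=[(x,\alpha)]$ for any label $\alpha$ with $\phi(c_i)=\alpha$ for infinitely many $i$ (this is well defined). The blow-up $\underline{\mathcal C}$ is the closure of the image of $\widetilde\Phi$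 in $\widetilde{\mathcal F}$, with the subspace topology. Then the completed configuration space $\widehat{\mathcal C}$ and the blow-up $\underline{\mathcal C}$ of two oriented lines in $\mathbb R^3$ are homeomorphic; more precisely, $\widetilde\Phi$ is a homeomorphism from $\widehat{\mathcal C}$ onto $\underline{\mathcal C}$. -/

import Mathlib

open Set Filter Topology
open scoped ENNReal Matrix

namespace TwoLines

/-- Euclidean three-space. -/
abbrev E3 : Type := EuclideanSpace ℝ (Fin 3)

/-- The space of oriented lines in Euclidean three-space: a line is recorded by its unit direction
vector (first component) and its point nearest to the origin (second component). It carries the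
metric induced from `ℝ³ × ℝ³` with its Euclidean metric. -/
abbrev OrientedLine : Type :=
  {p : WithLp 2 (E3 × E3) // ‖p.fst‖ = 1 ∧ inner ℝ p.fst p.snd = 0}

/-- The unit direction vector of an oriented line. -/
def OrientedLine.dir (l : OrientedLine) : E3 := l.1.fst

/-- The point of the line that is nearest to the origin. -/
def OrientedLine.foot (l : OrientedLine) : E3 := l.1.snd

/-- The set of points of the line. -/
def OrientedLine.carrier (l : OrientedLine) : Set E3 := {x | ∃ t : ℝ, x = l.foot + t • l.dir}

/-- The space of immersed configurations of the linkage consisting of `n` oriented lines: arbitrary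
`n`-tuples of oriented lines, with the Euclidean product metric. -/
abbrev Lines (n : ℕ) : Type := PiLp 2 (fun _ : Fin n => OrientedLine)

/-- A tuple of lines is embedded when its lines are pairwise disjoint. -/
def Embedded {n : ℕ} (c : Lines n) : Prop :=
  ∀ i j : Fin n, i ≠ j → Disjoint (c i).carrier (c j).carrier

/-- The configuration space of the linkage consisting of `n` oriented lines: all embedded
`n`-tuples. (There are no lengths to prescribe, so it equals the space of embeddings.)
Its metric, the path metric, is defined below. -/
@[ext] structure Conf (n : ℕ) where
  /-- the underlying tuple of lines -/
  lines : Lines n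
  /-- the lines are pairwise disjoint -/
  embedded : Embedded lines

/-- `γ` restricts to a continuous path in the space of embedded tuples, parametrized by `[0,1]`,
from `c` to `c'`. -/
def IsEmbPath {n : ℕ} (c c' : Lines n) (γ : ℝ → Lines n) : Prop :=
  ContinuousOn γ (Icc 0 1) ∧ γ 0 = c ∧ γ 1 = c' ∧ ∀ t ∈ Icc (0 : ℝ) 1, Embedded (γ t)

/-- The infimum of the lengths of the paths from `c` to `c'` through embedded tuples
(`∞` if there is no rectifiable path). -/
noncomputable def pathEDist {n : ℕ} (c c' : Lines n) : ℝ≥0∞ :=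
  ⨅ γ : {γ : ℝ → Lines n // IsEmbPath c c' γ}, eVariationOn γ.1 (Icc 0 1)

theorem pathEDist_self {n : ℕ} {c : Lines n} (hc : Embedded c) : pathEDist c c = 0 := by
  refine le_antisymm ?_ bot_le
  refine (iInf_le _ ⟨fun _ => c, continuousOn_const, rfl, rfl, fun _ _ => hc⟩).trans ?_
  exact (eVariationOn.constant_on (by
    rintro _ ⟨_, _, rfl⟩ _ ⟨_, _, rfl⟩; rfl)).le

theorem edist_le_pathEDist {n : ℕ} (c c' : Lines n) : edist c c' ≤ pathEDist c c' := by
  refine le_iInf ?_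
  rintro ⟨γ, _, h0, h1, _⟩
  have h := eVariationOn.edist_le γ (s := Icc (0 : ℝ) 1) (x := 0) (y := 1) (by simp) (by simp)
  rw [h0, h1] at h
  exact h

theorem pathEDist_comm_le {n : ℕ} (c c' : Lines n) : pathEDist c c' ≤ pathEDist c' c := by
  refine le_iInf ?_
  rintro ⟨γ, hc, h0, h1, he⟩
  have hm : MapsTo (fun t : ℝ => 1 - t) (Icc 0 1) (Icc 0 1) := by
    intro t ht
    simp only [mem_Icc] at ht ⊢
    constructor <;> linarith [ht.1, ht.2]
  refine (iInf_le _ ⟨γ ∘ fun t => 1 - t, hc.comp (by fun_prop) hm, by simp [h1], by simp [h0],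
    fun t ht => he _ (hm ht)⟩).trans ?_
  exact eVariationOn.comp_le_of_antitoneOn γ _ (fun a _ b _ hab => sub_le_sub_left hab 1) hm

theorem pathEDist_comm {n : ℕ} (c c' : Lines n) : pathEDist c c' = pathEDist c' c :=
  le_antisymm (pathEDist_comm_le c c') (pathEDist_comm_le c' c)

theorem pathEDist_triangle {n : ℕ} (c c' c'' : Lines n) :
    pathEDist c c'' ≤ pathEDist c c' + pathEDist c' c'' := by
  refine ENNReal.le_iInf_add_iInf ?_
  rintro ⟨γ, hc, h0, h1, he⟩ ⟨γ', hc', h0', h1', he'⟩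
  let δ : ℝ → Lines n := fun t => if t ≤ 1 / 2 then γ (2 * t) else γ' (2 * t - 1)
  have hl : EqOn δ (γ ∘ fun t => 2 * t) (Icc 0 (1 / 2)) := by
    intro t ht
    simp only [δ, Function.comp, if_pos ht.2]
  have hr : EqOn δ (γ' ∘ fun t => 2 * t - 1) (Icc (1 / 2) 1) := by
    intro t ht
    rcases eq_or_lt_of_le ht.1 with h | h
    · subst h
      simp only [δ, Function.comp, if_pos le_rfl]
      norm_num [h1, h0']
    · simp only [δ, Function.comp, if_neg (not_le.2 h)]
  have ml : MapsTo (fun t : ℝ => 2 * t) (Icc 0 (1 / 2)) (Icc 0 1) := by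
    intro t ht
    simp only [mem_Icc] at ht ⊢
    constructor <;> linarith [ht.1, ht.2]
  have mr : MapsTo (fun t : ℝ => 2 * t - 1) (Icc (1 / 2) 1) (Icc 0 1) := by
    intro t ht
    simp only [mem_Icc] at ht ⊢
    constructor <;> linarith [ht.1, ht.2]
  have hu : Icc (0 : ℝ) (1 / 2) ∪ Icc (1 / 2) 1 = Icc 0 1 :=
    Icc_union_Icc_eq_Icc (by norm_num) (by norm_num)
  have hδ : IsEmbPath c c'' δ := by
    refine ⟨?_, ?_, ?_, ?_⟩
    · rw [← hu]
      exact ContinuousOn.union_of_isClosed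
        ((hc.comp (by fun_prop) ml).congr hl) ((hc'.comp (by fun_prop) mr).congr hr)
        isClosed_Icc isClosed_Icc
    · rw [hl (by norm_num)]
      simpa using h0
    · rw [hr (by norm_num)]
      norm_num [h1']
    · intro t ht
      rw [← hu] at ht
      rcases ht with ht | ht
      · rw [hl ht]
        exact he _ (ml ht)
      · rw [hr ht]
        exact he' _ (mr ht)
  refine (iInf_le _ ⟨δ, hδ⟩).trans ?_
  have hs := eVariationOn.Icc_add_Icc δ (s := univ) (a := (0 : ℝ)) (b := 1 / 2) (c := 1)
    (by norm_num) (by norm_num) (mem_univ _)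
  simp only [univ_inter] at hs
  rw [← hs, eVariationOn.eq_of_eqOn hl, eVariationOn.eq_of_eqOn hr]
  exact add_le_add
    (eVariationOn.comp_le_of_monotoneOn γ _ (fun a _ b _ hab => by simpa using hab) ml)
    (eVariationOn.comp_le_of_monotoneOn γ' _ (fun a _ b _ hab => by simpa using hab) mr)

/-- The path metric: the path length distance, cut off at `1`. -/
noncomputable instance (n : ℕ) : MetricSpace (Conf n) where
  dist x y := (min (pathEDist x.lines y.lines) 1).toReal
  dist_self x := by simp [pathEDist_self x.embedded]
  dist_comm x y := by rw [pathEDist_comm]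
  dist_triangle x y z := by
    have h : min (pathEDist x.lines z.lines) 1
        ≤ min (pathEDist x.lines y.lines) 1 + min (pathEDist y.lines z.lines) 1 := by
      have := pathEDist_triangle x.lines y.lines z.lines
      rcases le_total (pathEDist x.lines y.lines) 1 with h1 | h1
      · rcases le_total (pathEDist y.lines z.lines) 1 with h2 | h2
        · rw [min_eq_left h1, min_eq_left h2]
          exact (min_le_left _ _).trans this
        · rw [min_eq_right h2]
          exact (min_le_right _ _).trans le_add_self
      · rw [min_eq_right h1]
        exact (min_le_right _ _).trans le_self_add
    have hf : ∀ a : ℝ≥0∞, min a 1 ≠ ∞ := fun a =>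
      ne_top_of_le_ne_top ENNReal.one_ne_top (min_le_right _ _)
    rw [← ENNReal.toReal_add (hf _) (hf _)]
    exact ENNReal.toReal_mono (ENNReal.add_ne_top.2 ⟨hf _, hf _⟩) h
  eq_of_dist_eq_zero {x y} h := by
    have hf : min (pathEDist x.lines y.lines) 1 ≠ ∞ :=
      ne_top_of_le_ne_top ENNReal.one_ne_top (min_le_right _ _)
    have h0 : min (pathEDist x.lines y.lines) 1 = 0 := by
      rcases (ENNReal.toReal_eq_zero_iff _).1 h with h | h
      · exact h
      · exact absurd h hf
    have h1 : pathEDist x.lines y.lines = 0 := by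
      rcases min_eq_iff.1 h0 with h | h
      · exact h.1
      · exact absurd h.1 one_ne_zero
    exact Conf.ext (edist_le_zero.1 ((edist_le_pathEDist _ _).trans h1.le))

/-- The completed configuration space: the metric completion with respect to the path metric. -/
abbrev CompletedConf (n : ℕ) : Type := UniformSpace.Completion (Conf n)

/-- `w` is a linking vector of `l` and `l'`: it leads from a point of `l` to a point of `l'` at
minimal distance from each other. -/
def IsLinkingVector (l l' : OrientedLine) (w : E3) : Prop :=
  ∃ a ∈ l.carrier, ∃ b ∈ l'.carrier, w = b - a ∧
    ∀ a' ∈ l.carrier, ∀ b' ∈ l'.carrier, dist a b ≤ dist a' b'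

/-- The linking vector (which is unique unless the lines are parallel and distinct). -/
noncomputable def linkingVector (l l' : OrientedLine) : E3 :=
  Classical.epsilon (IsLinkingVector l l')

open Classical in
/-- The linking number in `ℤ/3 = {-1, 0, 1}`: the sign of the triple product of the linking vector
and the two directions if the lines are not coplanar, and `0` otherwise. -/
noncomputable def linkingNumber (l l' : OrientedLine) : ZMod 3 :=
  if Coplanar ℝ (l.carrier ∪ l'.carrier) then 0
  else ((SignType.sign ((linkingVector l l').ofLp ⬝ᵥ (l.dir.ofLp ⨯₃ l'.dir.ofLp)) : ℤ) : ZMod 3)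

/-- The ordered pairs of distinct lines. -/
abbrev Pairs (n : ℕ) : Type := {ξ : Fin n × Fin n // ξ.1 ≠ ξ.2}

/-- Immersed configurations labelled by an element of `ℤ/3` for each ordered pair of distinct
lines, with the product topology (the labels being discrete). -/
abbrev Labelled (n : ℕ) : Type := Lines n × (Pairs n → ZMod 3)

/-- The linking number labels of an embedded configuration. -/
noncomputable def label {n : ℕ} (x : Conf n) : Pairs n → ZMod 3 :=
  fun ξ => linkingNumber (x.lines ξ.1.1) (x.lines ξ.1.2)

/-- The map from embedded configurations to labelled immersed configurations. -/
noncomputable def Phi {n : ℕ} (x : Conf n) : Labelled n := (x.lines, label x)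

/-- Two labellings `α`, `β` of the same immersed configuration are related if that configuration is
the limit of a sequence of embedded configurations which is Cauchy for the path metric and along
which each of the labels `α` and `β` occurs infinitely often. -/
def LabelRel (n : ℕ) (a b : Labelled n) : Prop :=
  a.1 = b.1 ∧ ∃ u : ℕ → Conf n, CauchySeq u ∧ Tendsto (fun i => (u i).lines) atTop (𝓝 a.1) ∧
    (∃ᶠ i in atTop, label (u i) = a.2) ∧ (∃ᶠ i in atTop, label (u i) = b.2)

/-- The quotient space of the space of labelled immersed configurations by the equivalence
relation generated by `LabelRel`, with the quotient topology. -/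
abbrev QuotLabelled (n : ℕ) : Type := Quot (LabelRel n)

/-- `y` is the class in the quotient determined by a sequence of embedded configurations
representing the point `p` of the completion: the class of the limiting immersed configuration
with a label that occurs infinitely often along the sequence. -/
def IsLimitClass {n : ℕ} (p : CompletedConf n) (y : QuotLabelled n) : Prop :=
  ∃ (u : ℕ → Conf n) (x : Lines n) (α : Pairs n → ZMod 3),
    Tendsto (fun i => (u i : CompletedConf n)) atTop (𝓝 p) ∧
    Tendsto (fun i => (u i).lines) atTop (𝓝 x) ∧
    (∃ᶠ i in atTop, label (u i) = α) ∧ y = Quot.mk _ (x, α)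

instance : CompleteSpace OrientedLine := by
  refine IsClosed.completeSpace_coe (hs := ?_)
  have h1 : Continuous fun p : WithLp 2 (E3 × E3) => p.fst := by fun_prop
  have h2 : Continuous fun p : WithLp 2 (E3 × E3) => p.snd := by fun_prop
  exact (isClosed_eq h1.norm continuous_const).inter
    (isClosed_eq (h1.inner h2) continuous_const)

theorem uniformContinuous_lines (n : ℕ) : UniformContinuous (Conf.lines (n := n)) := by
  refine Metric.uniformContinuous_iff.2 fun ε hε => ⟨min ε 1, by positivity, fun {x y} h => ?_⟩
  have hd : (min (pathEDist x.lines y.lines) 1).toReal < min ε 1 := h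
  have hf : min (pathEDist x.lines y.lines) 1 ≠ ∞ :=
    ne_top_of_le_ne_top ENNReal.one_ne_top (min_le_right _ _)
  have hlt := (ENNReal.lt_ofReal_iff_toReal_lt hf).2 hd
  have h1 : pathEDist x.lines y.lines < ENNReal.ofReal (min ε 1) := by
    rcases min_lt_iff.1 hlt with h | h
    · exact h
    · refine absurd h (not_lt.2 ?_)
      rw [← ENNReal.ofReal_one]
      exact ENNReal.ofReal_le_ofReal (min_le_right _ _)
  have h2 := (edist_le_pathEDist x.lines y.lines).trans_lt h1
  rw [edist_dist, ENNReal.ofReal_lt_ofReal_iff (by positivity)] at h2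
  exact h2.trans_le (min_le_left _ _)

theorem cauchySeq_of_tendsto_coe {n : ℕ} {u : ℕ → Conf n} {p : CompletedConf n}
    (h : Tendsto (fun i => (u i : CompletedConf n)) atTop (𝓝 p)) : CauchySeq u := by
  have hc : CauchySeq (fun i => (u i : CompletedConf n)) := h.cauchySeq
  rw [cauchySeq_iff_tendsto] at hc ⊢
  rw [(UniformSpace.Completion.isUniformInducing_coe (Conf n)).comap_uniformity.symm]
  exact tendsto_comap_iff.2 hc

theorem exists_tendsto_lines {n : ℕ} {u : ℕ → Conf n} (h : CauchySeq u) :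
    ∃ x, Tendsto (fun i => (u i).lines) atTop (𝓝 x) :=
  cauchySeq_tendsto_of_complete ((uniformContinuous_lines n).comp_cauchySeq h)

/-- The sequence `u 0, v 0, u 1, v 1, …`. -/
def interleave {X : Type*} (u v : ℕ → X) (i : ℕ) : X := if Even i then u (i / 2) else v (i / 2)

theorem tendsto_interleave {X : Type*} {u v : ℕ → X} {l : Filter X} (hu : Tendsto u atTop l)
    (hv : Tendsto v atTop l) : Tendsto (interleave u v) atTop l := by
  have hd : Tendsto (fun i : ℕ => i / 2) atTop atTop :=
    Nat.tendsto_div_const_atTop (by norm_num)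
  exact Tendsto.if' (hu.comp hd) (hv.comp hd)

theorem interleave_even {X : Type*} (u v : ℕ → X) (i : ℕ) : interleave u v (2 * i) = u i := by
  simp [interleave]

theorem interleave_odd {X : Type*} (u v : ℕ → X) (i : ℕ) : interleave u v (2 * i + 1) = v i := by
  have h : (2 * i + 1) / 2 = i := by omega
  simp [interleave, h]

theorem existsUnique_limitClass {n : ℕ} (p : CompletedConf n) : ∃! y, IsLimitClass p y := by
  have hex : ∃ y, IsLimitClass p y := by
    obtain ⟨v, hv, hp⟩ := mem_closure_iff_seq_limit.1
      ((UniformSpace.Completion.denseRange_coe (α := Conf n)) p)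
    choose u hu using hv
    have hp' : Tendsto (fun i => (u i : CompletedConf n)) atTop (𝓝 p) := by simpa only [hu] using hp
    obtain ⟨x, hx⟩ := exists_tendsto_lines (cauchySeq_of_tendsto_coe hp')
    have hα : ∃ α : Pairs n → ZMod 3, ∃ᶠ i in atTop, label (u i) = α := by
      by_contra! hno
      have hall : ∀ α : Pairs n → ZMod 3, ∀ᶠ i in atTop, label (u i) ≠ α :=
        hno
      obtain ⟨i, hi⟩ := (eventually_all.2 hall).exists
      exact hi _ rfl
    obtain ⟨α, hα⟩ := hα
    exact ⟨_, u, x, α, hp', hx, hα, rfl⟩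
  refine existsUnique_of_exists_of_unique hex ?_
  rintro _ _ ⟨u, x, α, hp, hx, hα, rfl⟩ ⟨v, y, β, hq, hy, hβ, rfl⟩
  have hw : Tendsto (fun i => ((interleave u v i : Conf n) : CompletedConf n)) atTop (𝓝 p) := by
    have h := tendsto_interleave (u := fun i => (u i : CompletedConf n))
      (v := fun i => (v i : CompletedConf n)) hp hq
    refine h.congr fun i => ?_
    unfold interleave
    split_ifs <;> rfl
  have h2 : Tendsto (fun i : ℕ => 2 * i) atTop atTop :=
    tendsto_atTop_mono (fun i => by simp only [id]; omega) tendsto_id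
  have h3 : Tendsto (fun i : ℕ => 2 * i + 1) atTop atTop := tendsto_atTop_mono (fun i => by omega) h2
  obtain ⟨z, hz⟩ := exists_tendsto_lines (cauchySeq_of_tendsto_coe hw)
  have hzx : z = x := by
    refine tendsto_nhds_unique (hz.comp h2) (hx.congr fun i => ?_)
    simp only [Function.comp, interleave_even]
  have hzy : z = y := by
    refine tendsto_nhds_unique (hz.comp h3) (hy.congr fun i => ?_)
    simp only [Function.comp, interleave_odd]
  subst hzx
  subst hzy
  refine Quot.sound ⟨rfl, interleave u v, cauchySeq_of_tendsto_coe hw, hz, ?_, ?_⟩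
  · refine h2.frequently (hα.mono fun i hi => ?_)
    rw [interleave_even]
    exact hi
  · refine h3.frequently (hβ.mono fun i hi => ?_)
    rw [interleave_odd]
    exact hi

/-- The map from the completed configuration space to the quotient of the space of labelled
immersed configurations that is induced by `Phi`. -/
noncomputable def PhiTilde {n : ℕ} (p : CompletedConf n) : QuotLabelled n :=
  (existsUnique_limitClass p).choose

/-- The blow-up: the closure of the image of the completed configuration space among the classes of
labelled immersed configurations. -/
def BlowUp (n : ℕ) : Set (QuotLabelled n) := closure (range (PhiTilde (n := n)))

end TwoLines

/-!
The argument rests on one geometric fact: two pairs of disjoint lines that carry the same label and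
are close to the same (possibly intersecting) pair `x` are close to each other in the path metric
(`EqualLabelsClose`, proved for two lines in `equalLabelsClose_two`).

From this fact the theorem follows formally. Let the stratum of a labelling `α` be the closure, in
the completion, of the configurations labelled `α`. The strata are a finite closed cover of the
completion, and on the stratum of `α` the map `PhiTilde` is `p ↦ [(limitLines p, α)]`; hence
`PhiTilde` is continuous. The geometric fact says that `limitLines` is injective on each stratum,
with closed images of closed sets. A Cauchy sequence witnessing `LabelRel` therefore converges to
the only point over `x` of either of the two strata concerned, so that `PhiTilde p = [(x, α)]` if
and only if `p` lies in the stratum of `α` and over `x` (`EqualLabelsClose.PhiTilde_eq_mk_iff`).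
It follows that `PhiTilde` is a closed embedding. In particular its range is closed, hence is
the blow-up.

For the geometric fact, describe a pair of lines by directions `a`, `b` that need not be
normalized, a point `p` on the first line and a vector `d` leading from `p` to the second. The
label of disjoint lines is the sign of `d · (a × b)`, and it vanishes for parallel lines only
(`linkingNumber_cases`). The passage from parameters to lines is locally Lipschitz, so it is enough
to join nearby parameters with `d · (a × b) > 0` by few short segments along which this triple
product stays positive (`gathersAt_paramTriple`). If the lines of `x` do not coincide,
the triple product has a nonzero derivative at `x` in some direction, and a shift in this direction
makes room for everything else. If they coincide, the triple product is a quadratic form in the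
two small vectors `b - σ a` and `d`, and these can be moved, along suitable segments, to a fixed
small frame of a plane transverse to `a`. The negative sign is reduced to the positive one by
reversing the second line, and disjoint parallel lines are turned slightly to get a positive sign.
-/

namespace TwoLines

/-! ### The strata of the completion and the reduction to a geometric property -/

/-- The map from the completed configuration space to tuples of lines that extends
`Conf.lines`. -/
noncomputable def limitLines {n : ℕ} : CompletedConf n → Lines n :=
  UniformSpace.Completion.extension Conf.lines

theorem continuous_limitLines {n : ℕ} : Continuous (limitLines (n := n)) :=
  UniformSpace.Completion.continuous_extension

theorem limitLines_coe {n : ℕ} (c : Conf n) : limitLines (c : CompletedConf n) = c.lines :=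
  UniformSpace.Completion.extension_coe (uniformContinuous_lines n) c

/-- The closed stratum of the completion that belongs to the labelling `α`: the points which are
limits of embedded configurations with labelling `α`. -/
def stratum {n : ℕ} (α : Pairs n → ZMod 3) : Set (CompletedConf n) :=
  closure ((fun c : Conf n => (c : CompletedConf n)) '' {c | label c = α})

theorem isClosed_stratum {n : ℕ} (α : Pairs n → ZMod 3) : IsClosed (stratum α) := isClosed_closure

theorem iUnion_stratum (n : ℕ) : ⋃ α : Pairs n → ZMod 3, stratum α = univ := by
  unfold stratum
  rw [← closure_iUnion_of_finite, ← image_iUnion]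
  have : ⋃ α : Pairs n → ZMod 3, {c : Conf n | label c = α} = univ := by
    ext c; simp
  rw [this, image_univ]
  exact (UniformSpace.Completion.denseRange_coe (α := Conf n)).closure_range

theorem isLimitClass_PhiTilde {n : ℕ} (p : CompletedConf n) : IsLimitClass p (PhiTilde p) :=
  (existsUnique_limitClass p).choose_spec.1

theorem PhiTilde_of_mem_stratum {n : ℕ} {p : CompletedConf n} {α : Pairs n → ZMod 3}
    (hp : p ∈ stratum α) : PhiTilde p = Quot.mk _ (limitLines p, α) := by
  obtain ⟨v, hv, hvp⟩ := mem_closure_iff_seq_limit.1 hp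
  choose u hu huv using hv
  have hup : Tendsto (fun i => (u i : CompletedConf n)) atTop (𝓝 p) := by
    simpa only [huv] using hvp
  refine (existsUnique_limitClass p).unique (isLimitClass_PhiTilde p)
    ⟨u, limitLines p, α, hup, ?_, Frequently.of_forall hu, rfl⟩
  simpa only [Function.comp_def, limitLines_coe] using (continuous_limitLines.tendsto p).comp hup

theorem continuous_PhiTilde (n : ℕ) : Continuous (PhiTilde (n := n)) := by
  refine (locallyFinite_of_finite stratum).continuous (iUnion_stratum n) isClosed_stratum
    fun α => ContinuousOn.congr (f := fun p => Quot.mk _ (limitLines p, α)) ?_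
      fun p hp => PhiTilde_of_mem_stratum hp
  exact (continuous_quot_mk.comp
    (continuous_limitLines.prodMk continuous_const)).continuousOn

/-- The geometric property of the linkage on which the comparison with the blow-up rests:
embedded configurations with the same labelling that are close to the same immersed configuration
are close to each other in the path metric. -/
def EqualLabelsClose (n : ℕ) : Prop :=
  ∀ (x : Lines n) (α : Pairs n → ZMod 3), ∀ ε > 0, ∃ δ > 0, ∀ c c' : Conf n,
    label c = α → label c' = α → dist c.lines x < δ → dist c'.lines x < δ → dist c c' < ε

theorem EqualLabelsClose.dist_le_of_mem_stratum {n : ℕ} (H : EqualLabelsClose n)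
    (x : Lines n) (α : Pairs n → ZMod 3) {ε : ℝ} (hε : 0 < ε) :
    ∃ δ > 0, ∀ p ∈ stratum α, ∀ q ∈ stratum α, dist (limitLines p) x < δ →
      dist (limitLines q) x < δ → dist p q ≤ ε := by
  obtain ⟨δ, hδ, h⟩ := H x α ε hε
  refine ⟨δ, hδ, fun p hp q hq hpx hqx => ?_⟩
  set S : Set (CompletedConf n) := limitLines ⁻¹' Metric.ball x δ ∩
    ((fun c : Conf n => (c : CompletedConf n)) '' {c | label c = α})
  have hU : IsOpen (limitLines ⁻¹' Metric.ball x δ) :=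
    Metric.isOpen_ball.preimage continuous_limitLines
  have hpq : (p, q) ∈ closure (S ×ˢ S) := by
    rw [closure_prod_eq]
    exact ⟨hU.inter_closure ⟨hpx, hp⟩, hU.inter_closure ⟨hqx, hq⟩⟩
  refine closure_minimal (t := {r : CompletedConf n × CompletedConf n | dist r.1 r.2 ≤ ε})
    ?_ (isClosed_le continuous_dist continuous_const) hpq
  rintro ⟨_, _⟩ ⟨⟨h1, c, hc, rfl⟩, ⟨h2, c', hc', rfl⟩⟩
  simp only [mem_preimage, limitLines_coe, Metric.mem_ball] at h1 h2
  simpa only [mem_ofPred_eq, UniformSpace.Completion.dist_eq] using (h c c' hc hc' h1 h2).le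

theorem EqualLabelsClose.injOn_limitLines {n : ℕ} (H : EqualLabelsClose n) (α : Pairs n → ZMod 3) :
    InjOn limitLines (stratum α) := by
  intro p hp q hq hpq
  refine dist_le_zero.1 (le_of_forall_pos_le_add fun ε hε => ?_)
  obtain ⟨δ, hδ, h⟩ := H.dist_le_of_mem_stratum (limitLines q) α hε
  simpa using h p hp q hq (by simpa [hpq] using hδ) (by simpa using hδ)

theorem EqualLabelsClose.isClosed_image_limitLines {n : ℕ} (H : EqualLabelsClose n)
    (α : Pairs n → ZMod 3)
    {T : Set (CompletedConf n)} (hT : IsClosed T) (hTα : T ⊆ stratum α) :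
    IsClosed (limitLines '' T) := by
  refine isClosed_of_closure_subset fun x hx => ?_
  obtain ⟨y, hy, hyx⟩ := mem_closure_iff_seq_limit.1 hx
  choose s hs hsy using hy
  have hsx : Tendsto (fun i => limitLines (s i)) atTop (𝓝 x) := by simpa only [hsy] using hyx
  have hc : CauchySeq s := by
    refine Metric.cauchySeq_iff.2 fun ε hε => ?_
    obtain ⟨δ, hδ, h⟩ := H.dist_le_of_mem_stratum x α (half_pos hε)
    obtain ⟨N, hN⟩ := Metric.tendsto_atTop.1 hsx δ hδ
    exact ⟨N, fun i hi j hj => (h _ (hTα (hs i)) _ (hTα (hs j)) (hN i hi) (hN j hj)).trans_lt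
      (half_lt_self hε)⟩
  obtain ⟨p, hp⟩ := cauchySeq_tendsto_of_complete hc
  exact ⟨p, hT.mem_of_tendsto hp (Eventually.of_forall hs),
    tendsto_nhds_unique ((continuous_limitLines.tendsto p).comp hp) hsx⟩

/-- A Cauchy sequence that witnesses `LabelRel` converges to a point common to two strata; it is
the only point of either stratum over its immersed configuration. Hence lying in a stratum is
inherited along the equivalence relation. -/
theorem EqualLabelsClose.mem_stratum_of_labelRel {n : ℕ} (H : EqualLabelsClose n)
    {a b : Labelled n} (hab : LabelRel n a b)
    {s : CompletedConf n} (hs : s ∈ stratum a.2 ∧ limitLines s = a.1) :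
    s ∈ stratum b.2 ∧ limitLines s = b.1 := by
  obtain ⟨h1, u, hu, hua, hfa, hfb⟩ := hab
  obtain ⟨p, hp⟩ := cauchySeq_tendsto_of_complete
    ((UniformSpace.Completion.uniformContinuous_coe (Conf n)).comp_cauchySeq hu)
  have hmem : ∀ α : Pairs n → ZMod 3, (∃ᶠ i in atTop, label (u i) = α) →
      p ∈ stratum α := fun α hα =>
    mem_closure_of_frequently_of_tendsto (hα.mono fun i hi => mem_image_of_mem _ hi) hp
  have hpa : limitLines p = a.1 := by
    refine tendsto_nhds_unique ((continuous_limitLines.tendsto p).comp hp) ?_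
    simpa only [Function.comp_def, limitLines_coe] using hua
  have hsp : s = p := H.injOn_limitLines a.2 hs.1 (hmem _ hfa) (hs.2.trans hpa.symm)
  exact ⟨hsp ▸ hmem _ hfb, hs.2.trans h1⟩

theorem EqualLabelsClose.PhiTilde_eq_mk_iff {n : ℕ} (H : EqualLabelsClose n)
    {s : CompletedConf n} {y : Labelled n} :
    PhiTilde s = Quot.mk _ y ↔ s ∈ stratum y.2 ∧ limitLines s = y.1 := by
  constructor
  · intro h
    obtain ⟨α, hα⟩ := mem_iUnion.1 (iUnion_stratum n ▸ mem_univ s)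
    -- The right-hand side is constant on equivalence classes, so it descends to the quotient.
    let T : QuotLabelled n → Prop := Quot.lift
      (fun a : Labelled n => s ∈ stratum a.2 ∧ limitLines s = a.1) fun a b hab =>
        propext ⟨H.mem_stratum_of_labelRel hab, H.mem_stratum_of_labelRel
          ⟨hab.1.symm, hab.2.imp fun u hu => ⟨hu.1, hab.1 ▸ hu.2.1, hu.2.2.2, hu.2.2.1⟩⟩⟩
    have h1 : T (Quot.mk _ (limitLines s, α)) := ⟨hα, rfl⟩
    rw [← PhiTilde_of_mem_stratum hα, h] at h1
    exact h1
  · rintro ⟨h1, h2⟩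
    rw [PhiTilde_of_mem_stratum h1, h2]

theorem EqualLabelsClose.isClosedEmbedding_PhiTilde {n : ℕ} (H : EqualLabelsClose n) :
    IsClosedEmbedding (PhiTilde (n := n)) := by
  refine .of_continuous_injective_isClosedMap (continuous_PhiTilde n) ?_ ?_
  · intro p q hpq
    obtain ⟨α, hα⟩ := mem_iUnion.1 (iUnion_stratum n ▸ mem_univ p)
    rw [PhiTilde_of_mem_stratum hα] at hpq
    have hq := H.PhiTilde_eq_mk_iff.1 hpq.symm
    exact H.injOn_limitLines α hα hq.1 hq.2.symm
  · intro S hS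
    rw [← (isQuotientMap_quot_mk (r := LabelRel n)).isClosed_preimage]
    have : Quot.mk (LabelRel n) ⁻¹' (PhiTilde '' S) = ⋃ α : Pairs n → ZMod 3,
        (limitLines '' (S ∩ stratum α)) ×ˢ {α} := by
      ext ⟨x, α⟩
      simp only [mem_preimage, mem_image, H.PhiTilde_eq_mk_iff, mem_iUnion, mem_prod,
        mem_singleton_iff, mem_inter_iff]
      constructor
      · rintro ⟨s, h1, h2, h3⟩
        exact ⟨α, ⟨s, ⟨h1, h2⟩, h3⟩, rfl⟩
      · rintro ⟨_, ⟨s, ⟨h1, h2⟩, h3⟩, rfl⟩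
        exact ⟨s, h1, h2, h3⟩
    rw [this]
    exact isClosed_iUnion_of_finite fun α => (H.isClosed_image_limitLines α
      (hS.inter (isClosed_stratum α)) inter_subset_right).prod (isClosed_discrete _)

theorem EqualLabelsClose.exists_homeomorph {n : ℕ} (H : EqualLabelsClose n) :
    ∃ h : CompletedConf n ≃ₜ BlowUp n,
      ∀ p : CompletedConf n, (h p : QuotLabelled n) = PhiTilde p :=
  have he := H.isClosedEmbedding_PhiTilde
  ⟨he.isEmbedding.toHomeomorph.trans (.setCongr he.isClosed_range.closure_eq.symm), fun _ => rfl⟩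

/-! ### Triple products and linking numbers -/

/-- The cross product on Euclidean three-space. -/
def cross (a b : E3) : E3 := WithLp.toLp 2 (a.ofLp ⨯₃ b.ofLp)

/-- The triple product `d · (a × b)`. -/
def triple (d a b : E3) : ℝ := d.ofLp ⬝ᵥ (a.ofLp ⨯₃ b.ofLp)

theorem triple_eq (d a b : E3) : triple d a b = d 0 * (a 1 * b 2 - a 2 * b 1) +
    d 1 * (a 2 * b 0 - a 0 * b 2) + d 2 * (a 0 * b 1 - a 1 * b 0) := by
  rw [triple, cross_apply, Matrix.vec3_dotProduct]
  rfl

theorem cross_zero (a b : E3) : cross a b 0 = a 1 * b 2 - a 2 * b 1 := by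
  simp [cross, cross_apply]

theorem cross_one (a b : E3) : cross a b 1 = a 2 * b 0 - a 0 * b 2 := by
  simp [cross, cross_apply]

theorem cross_two (a b : E3) : cross a b 2 = a 0 * b 1 - a 1 * b 0 := by
  simp [cross, cross_apply]

theorem ext_coord {a b : E3} (h0 : a 0 = b 0) (h1 : a 1 = b 1) (h2 : a 2 = b 2) : a = b := by
  ext i; fin_cases i <;> assumption

theorem cross_eq_zero_iff {a b : E3} : cross a b = 0 ↔
    a 1 * b 2 - a 2 * b 1 = 0 ∧ a 2 * b 0 - a 0 * b 2 = 0 ∧ a 0 * b 1 - a 1 * b 0 = 0 := by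
  rw [← cross_zero, ← cross_one, ← cross_two]
  exact ⟨fun h => by simp [h], fun h => ext_coord h.1 h.2.1 h.2.2⟩

/-- The squared length of the cross product. -/
theorem triple_cross_self_pos {a b : E3} (h : cross a b ≠ 0) : 0 < triple (cross a b) a b := by
  have hn : triple (cross a b) a b = ‖cross a b‖ ^ 2 := by
    rw [EuclideanSpace.real_norm_sq_eq, Fin.sum_univ_three, triple_eq, cross_zero, cross_one,
      cross_two]
    ring
  rw [hn]
  positivity

/-- Cramer's rule: a vector `d` in the plane spanned by `a` and `b` is a linear combination of
them. -/
theorem exists_eq_smul_add_smul {d a b : E3} (h : cross a b ≠ 0) (hd : triple d a b = 0) :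
    ∃ s t : ℝ, d = s • a + t • b := by
  have hn := (triple_cross_self_pos h).ne'
  refine ⟨triple (cross d b) a b / triple (cross a b) a b,
    triple (cross a d) a b / triple (cross a b) a b, ?_⟩
  have key : triple (cross a b) a b • d =
      triple (cross d b) a b • a + triple (cross a d) a b • b + triple d a b • cross a b := by
    refine ext_coord ?_ ?_ ?_ <;>
    · simp only [PiLp.smul_apply, PiLp.add_apply, smul_eq_mul, triple_eq, cross_zero, cross_one,
        cross_two]
      ring
  rw [hd, zero_smul, add_zero] at key
  rw [div_eq_inv_mul, div_eq_inv_mul, mul_smul, mul_smul, ← smul_add, ← key, inv_smul_smul₀ hn]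

/-- A vector parallel to a nonzero vector is a multiple of it. -/
theorem exists_eq_smul_of_cross_eq_zero {a b : E3} (ha : a ≠ 0) (h : cross a b = 0) :
    ∃ r : ℝ, b = r • a := by
  have hn : ‖a‖ ^ 2 ≠ 0 := by positivity
  refine ⟨(a 0 * b 0 + a 1 * b 1 + a 2 * b 2) / ‖a‖ ^ 2, ?_⟩
  rw [div_eq_inv_mul, mul_smul, eq_inv_smul_iff₀ hn, EuclideanSpace.real_norm_sq_eq,
    Fin.sum_univ_three]
  obtain ⟨h0, h1, h2⟩ := cross_eq_zero_iff.1 h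
  refine ext_coord ?_ ?_ ?_ <;> simp only [PiLp.smul_apply, smul_eq_mul]
  · linear_combination a 2 * h1 - a 1 * h2
  · linear_combination a 0 * h2 - a 2 * h0
  · linear_combination a 1 * h0 - a 0 * h1

/-- The triple product of two lines: its sign tells on which side the second line passes the
first, and it vanishes when the lines are coplanar. -/
def lineTriple (l l' : OrientedLine) : ℝ := triple (l'.foot - l.foot) l.dir l'.dir

theorem cross_dir_eq_zero {l l' : OrientedLine} (hd : Disjoint l.carrier l'.carrier)
    (h : lineTriple l l' = 0) : cross l.dir l'.dir = 0 := by
  by_contra hc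
  obtain ⟨s, t, hst⟩ := exists_eq_smul_add_smul hc h
  refine Set.disjoint_left.1 hd (show l.foot + s • l.dir ∈ l.carrier from ⟨s, rfl⟩) ⟨-t, ?_⟩
  rw [neg_smul, ← sub_eq_add_neg, eq_sub_iff_add_eq, add_assoc, ← hst]
  abel

theorem OrientedLine.dir_ne_zero (l : OrientedLine) : l.dir ≠ 0 := by
  have h : ‖l.dir‖ = 1 := l.2.1
  intro h0
  simp [h0] at h

theorem coplanar_of_cross_dir_eq_zero {l l' : OrientedLine} (h : cross l.dir l'.dir = 0) :
    Coplanar ℝ (l.carrier ∪ l'.carrier) := by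
  obtain ⟨r, hr⟩ := exists_eq_smul_of_cross_eq_zero l.dir_ne_zero h
  have hp : ∀ p ∈ l.carrier ∪ l'.carrier, ∃ a b : ℝ,
      p = l.foot + a • l.dir + b • (l'.foot - l.foot) := by
    rintro p (⟨t, rfl⟩ | ⟨t, rfl⟩)
    · exact ⟨t, 0, by simp⟩
    · exact ⟨t * r, 1, by rw [hr, smul_smul, one_smul]; abel⟩
  rw [coplanar_iff_finrank_le_two]
  have hle : vectorSpan ℝ (l.carrier ∪ l'.carrier) ≤
      Submodule.span ℝ {l.dir, l'.foot - l.foot} := by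
    refine Submodule.span_le.2 ?_
    rintro _ ⟨p, hp1, q, hq1, rfl⟩
    obtain ⟨a, b, rfl⟩ := hp p hp1
    obtain ⟨a', b', rfl⟩ := hp q hq1
    refine Submodule.mem_span_pair.2 ⟨a - a', b - b', ?_⟩
    simp only [vsub_eq_sub]
    module
  exact (Submodule.finrank_mono hle).trans (by
    classical
    simpa using (finrank_span_le_card (R := ℝ) {l.dir, l'.foot - l.foot}).trans
      (by rw [toFinset_insert, toFinset_singleton]; exact Finset.card_le_two))

/-- The directions of two coplanar lines and the difference of their feet lie in a plane, hence are
orthogonal to a nonzero vector; so their determinant vanishes. -/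
theorem lineTriple_eq_zero_of_coplanar {l l' : OrientedLine}
    (h : Coplanar ℝ (l.carrier ∪ l'.carrier)) : lineTriple l l' = 0 := by
  set W := vectorSpan ℝ (l.carrier ∪ l'.carrier)
  have hW : Wᗮ ≠ ⊥ := by
    intro h0
    have h1 := W.finrank_add_finrank_orthogonal
    have h2 : Module.finrank ℝ W ≤ 2 := h.finrank_le_two
    rw [h0, finrank_bot, finrank_euclideanSpace_fin] at h1
    omega
  obtain ⟨w, hw, hw0⟩ := Submodule.exists_mem_ne_zero_of_ne_bot hW
  have hf : l.foot ∈ l.carrier := ⟨0, by simp⟩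
  have hf' : l'.foot ∈ l'.carrier := ⟨0, by simp⟩
  have hg : l.foot + l.dir ∈ l.carrier := ⟨1, by simp⟩
  have hg' : l'.foot + l'.dir ∈ l'.carrier := ⟨1, by simp⟩
  have e1 : inner ℝ (l'.foot - l.foot) w = 0 :=
    hw _ (vsub_mem_vectorSpan ℝ (Or.inr hf') (Or.inl hf))
  have e2 : inner ℝ l.dir w = 0 := by
    simpa using hw _ (vsub_mem_vectorSpan ℝ (Or.inl hg) (Or.inl hf))
  have e3 : inner ℝ l'.dir w = 0 := by
    simpa using hw _ (vsub_mem_vectorSpan ℝ (Or.inr hg') (Or.inr hf'))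
  rw [lineTriple, triple, triple_product_eq_det]
  refine Matrix.exists_mulVec_eq_zero_iff.1 ⟨w.ofLp, fun h0 => hw0 ?_, ?_⟩
  · ext i; exact congrFun h0 i
  · simp only [EuclideanSpace.inner_eq_star_dotProduct, star_trivial, dotProduct_comm w.ofLp]
      at e1 e2 e3
    ext i
    fin_cases i
    · exact e1
    · exact e2
    · exact e3

theorem exists_isLinkingVector (l l' : OrientedLine) : ∃ w, IsLinkingVector l l' w := by
  set W := Submodule.span ℝ {l.dir, l'.dir}
  obtain ⟨y, hy, hmin⟩ := W.exists_norm_eq_iInf_of_complete_subspace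
    (Submodule.complete_of_finiteDimensional W) (l'.foot - l.foot)
  obtain ⟨s, t, rfl⟩ := Submodule.mem_span_pair.1 hy
  refine ⟨_, l.foot + s • l.dir, ⟨s, rfl⟩, l'.foot + (-t) • l'.dir, ⟨-t, rfl⟩, rfl, ?_⟩
  rintro _ ⟨s', rfl⟩ _ ⟨t', rfl⟩
  have hle : ⨅ w : W, ‖l'.foot - l.foot - w‖ ≤ ‖l'.foot - l.foot - (s' • l.dir + (-t') • l'.dir)‖ :=
    ciInf_le ⟨0, by rintro _ ⟨_, rfl⟩; positivity⟩
      (⟨_, Submodule.mem_span_pair.2 ⟨s', -t', rfl⟩⟩ : W)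
  replace hle := hmin.le.trans hle
  rw [dist_comm, dist_eq_norm, dist_comm, dist_eq_norm]
  convert hle using 1 <;> congr 1 <;> module

theorem IsLinkingVector.triple_eq_lineTriple {l l' : OrientedLine} {w : E3}
    (h : IsLinkingVector l l' w) : triple w l.dir l'.dir = lineTriple l l' := by
  obtain ⟨_, ⟨s, rfl⟩, _, ⟨t, rfl⟩, rfl, -⟩ := h
  simp only [lineTriple, triple_eq, PiLp.sub_apply, PiLp.add_apply, PiLp.smul_apply, smul_eq_mul]
  ring

/-- The linking number of disjoint lines is the sign of their triple product, and it vanishes for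
parallel lines only. -/
theorem linkingNumber_cases {l l' : OrientedLine} (hd : Disjoint l.carrier l'.carrier) :
    (linkingNumber l l' = 1 ∧ 0 < lineTriple l l') ∨
    (linkingNumber l l' = -1 ∧ lineTriple l l' < 0) ∨
    (linkingNumber l l' = 0 ∧ cross l.dir l'.dir = 0) := by
  by_cases hc : Coplanar ℝ (l.carrier ∪ l'.carrier)
  · exact Or.inr (Or.inr ⟨if_pos hc, cross_dir_eq_zero hd (lineTriple_eq_zero_of_coplanar hc)⟩)
  · have hw : triple (linkingVector l l') l.dir l'.dir = lineTriple l l' :=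
      (Classical.epsilon_spec (exists_isLinkingVector l l')).triple_eq_lineTriple
    have hl : linkingNumber l l' = ((SignType.sign (lineTriple l l') : ℤ) : ZMod 3) := by
      rw [linkingNumber, if_neg hc, ← hw, triple]
    have h0 : lineTriple l l' ≠ 0 := fun h =>
      hc (coplanar_of_cross_dir_eq_zero (cross_dir_eq_zero hd h))
    rcases h0.lt_or_gt with h | h
    · exact Or.inr (Or.inl ⟨by rw [hl, sign_neg h]; simp, h⟩)
    · exact Or.inl ⟨by rw [hl, sign_pos h]; simp, h⟩

/-- Disjoint parallel lines are distinct. -/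
theorem cross_foot_sub_foot_ne_zero {l l' : OrientedLine} (hd : Disjoint l.carrier l'.carrier) :
    cross (l'.foot - l.foot) l.dir ≠ 0 := by
  intro h
  obtain ⟨r, hr⟩ := exists_eq_smul_of_cross_eq_zero (b := l'.foot - l.foot) l.dir_ne_zero (by
    rw [cross_eq_zero_iff] at h ⊢
    exact ⟨by linarith [h.1], by linarith [h.2.1], by linarith [h.2.2]⟩)
  exact Set.disjoint_left.1 hd (show l'.foot ∈ l.carrier from ⟨r, by rw [← hr]; abel⟩)
    ⟨0, by simp⟩

/-! ### Joining parameters with positive triple product -/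

/-- `f` gathers its positive points near `z₀`: inside any neighbourhood `U` of `z₀` there is a
point `y` to which every point sufficiently close to `z₀` with `0 < f` can be joined by three line
segments that stay in `U` and in the region `0 < f`. -/
def GathersAt {E : Type*} [TopologicalSpace E] [AddCommGroup E] [Module ℝ E]
    (f : E → ℝ) (z₀ : E) : Prop :=
  ∀ U ∈ 𝓝 z₀, ∃ y, ∀ᶠ z in 𝓝 z₀, 0 < f z → ∃ z₁ z₂,
    segment ℝ z z₁ ⊆ U ∩ {w | 0 < f w} ∧ segment ℝ z₁ z₂ ⊆ U ∩ {w | 0 < f w} ∧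
    segment ℝ z₂ y ⊆ U ∩ {w | 0 < f w}

/-- If `f` increases at a positive rate in some direction `N` near `z₀`, then its positive points
are gathered: a shift by a small multiple of `N` increases `f` along the way, and it increases `f`
by so much that the shifted points can move freely. -/
theorem gathersAt_of_affine {E : Type*} [NormedAddCommGroup E] [NormedSpace ℝ E] {f g : E → ℝ}
    {z₀ N : E} (hf : ContinuousAt f z₀) (hg : ContinuousAt g z₀) (hg₀ : 0 < g z₀)
    (h : ∀ z (t : ℝ), f (z + t • N) = f z + t * g z) : GathersAt f z₀ := by
  intro U hU
  rcases lt_or_ge (f z₀) 0 with hneg | hpos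
  · exact ⟨z₀, (hf.eventually_lt_const hneg).mono fun z hz hz' => absurd hz' hz.not_gt⟩
  obtain ⟨r, hr, hrU⟩ := Metric.mem_nhds_iff.1 hU
  obtain ⟨η, hη, hηr⟩ : ∃ η : ℝ, 0 < η ∧ η * ‖N‖ < r / 2 := by
    refine ⟨r / 2 / (‖N‖ + 1), by positivity, ?_⟩
    rw [div_mul_eq_mul_div, div_lt_iff₀ (by positivity)]
    nlinarith [norm_nonneg N]
  have hev : ∀ᶠ z in 𝓝 z₀, z ∈ Metric.ball z₀ (r / 2) ∧ g z₀ / 2 < g z ∧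
      f z₀ - η * (g z₀ / 2) < f z :=
    Eventually.and (Metric.ball_mem_nhds z₀ (half_pos hr))
      ((hg.eventually_const_lt (half_lt_self hg₀)).and
        (hf.eventually_const_lt (sub_lt_self _ (by positivity))))
  obtain ⟨δ, hδ, hδP⟩ := Metric.eventually_nhds_iff_ball.1 hev
  have hshift : ∀ z ∈ Metric.ball z₀ δ, ∀ t ∈ Icc (0 : ℝ) 1, z + (t * η) • N ∈ U := by
    intro z hz t ht
    refine hrU ?_
    have h1 : dist (z + (t * η) • N) z ≤ r / 2 := by
      rw [dist_eq_norm, add_sub_cancel_left, norm_smul, Real.norm_of_nonneg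
        (mul_nonneg ht.1 hη.le)]
      nlinarith [mul_le_of_le_one_left (mul_nonneg hη.le (norm_nonneg N)) ht.2]
    have h2 : dist z z₀ < r / 2 := (hδP z hz).1
    exact (dist_triangle _ z _).trans_lt (by linarith)
  -- The shift gains more than `η * (g z₀ / 2)`, while `f z` lies below zero by less than this.
  have hfar : ∀ z ∈ Metric.ball z₀ δ, z + η • N ∈ U ∩ {w | 0 < f w} := by
    intro z hz
    refine ⟨by simpa using hshift z hz 1 (by simp), ?_⟩
    obtain ⟨-, h1, h2⟩ := hδP z hz
    change 0 < f (z + η • N)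
    rw [h]
    nlinarith
  refine ⟨z₀ + η • N, Metric.eventually_nhds_iff_ball.2 ⟨δ, hδ, fun z hz hfz =>
    ⟨z + η • N, z₀ + η • N, ?_, ?_, ?_⟩⟩⟩
  · rintro _ ⟨a, b, ha, hb, hab, rfl⟩
    have : a • z + b • (z + η • N) = z + (b * η) • N := by
      rw [smul_add, ← add_assoc, ← add_smul, hab, one_smul, smul_smul]
    rw [this]
    refine ⟨hshift z hz b ⟨hb, by linarith⟩, ?_⟩
    obtain ⟨-, h1, -⟩ := hδP z hz
    change 0 < f _
    rw [h]
    have : 0 < g z := (half_pos hg₀).trans h1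
    positivity
  · rintro _ ⟨a, b, ha, hb, hab, rfl⟩
    have : a • (z + η • N) + b • (z₀ + η • N) = (a • z + b • z₀) + η • N := by
      rw [smul_add, smul_add, add_add_add_comm, ← add_smul, hab, one_smul]
    rw [this]
    exact hfar _ ((convex_ball z₀ δ) hz (Metric.mem_ball_self hδ) ha hb hab)
  · rw [segment_same]
    exact singleton_subset_iff.2 (hfar _ (Metric.mem_ball_self hδ))

theorem GathersAt.map {E : Type*} [TopologicalSpace E] [AddCommGroup E] [Module ℝ E] {f : E → ℝ}
    {z₀ : E} (h : GathersAt f z₀) (Q : E ≃L[ℝ] E) (hQ : ∀ z, f (Q z) = f z) :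
    GathersAt f (Q z₀) := by
  intro U hU
  obtain ⟨y, hy⟩ := h (Q ⁻¹' U) (Q.continuous.continuousAt.preimage_mem_nhds hU)
  have hseg : ∀ z z', segment ℝ z z' ⊆ Q ⁻¹' U ∩ {w | 0 < f w} →
      segment ℝ (Q z) (Q z') ⊆ U ∩ {w | 0 < f w} := by
    intro z z' hs
    have := image_segment ℝ (Q : E →ₗ[ℝ] E).toAffineMap z z'
    simp only [LinearMap.coe_toAffineMap] at this
    change Q '' segment ℝ z z' = segment ℝ (Q z) (Q z') at this
    rw [← this]
    rintro _ ⟨w, hw, rfl⟩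
    exact ⟨(hs hw).1, by simpa only [mem_ofPred_eq, hQ] using (hs hw).2⟩
  have ht : Tendsto Q.symm (𝓝 (Q z₀)) (𝓝 z₀) := by
    simpa using Q.symm.continuous.tendsto (Q z₀)
  refine ⟨Q y, (ht.eventually hy).mono fun z hz hfz => ?_⟩
  obtain ⟨z₁, z₂, h1, h2, h3⟩ := hz (by rwa [← hQ, Q.apply_symm_apply])
  refine ⟨Q z₁, Q z₂, ?_, hseg _ _ h2, hseg _ _ h3⟩
  simpa using hseg _ _ h1

/-- Parameters `(a, p, b, d)` for a pair of lines: the first passes through `p` with direction `a`,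
the second passes through `p + d` with direction `b`; directions need not be normalized. -/
abbrev Params : Type := E3 × E3 × E3 × E3

/-- The triple product of the pair of lines with the given parameters. -/
def paramTriple (z : Params) : ℝ := triple z.2.2.2 z.1 z.2.2.1

theorem continuous_paramTriple : Continuous paramTriple := by
  unfold paramTriple
  simp only [triple_eq]
  fun_prop

theorem exists_cross_ne_zero {a : E3} (ha : a ≠ 0) : ∃ e : E3, cross a e ≠ 0 := by
  by_contra! h
  refine ha ?_
  have h1 := cross_eq_zero_iff.1 (h (EuclideanSpace.single 0 1))
  have h2 := cross_eq_zero_iff.1 (h (EuclideanSpace.single 1 1))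
  simp at h1 h2
  exact ext_coord h2.2 h1.2 h1.1

/-- With `a` fixed, `paramTriple` is a quadratic form in the pair `(b, d)` of small vectors. It is
positive at the pair `(e, e')` when `e'` is the cross product of `a` and `e`. A segment from a
positive pair to one of `± η • (e, e')` stays positive if the sign is chosen so that the mixed
term is nonnegative, and both of these pairs are joined to `η • (e', -e)` through positive
values. -/
theorem gathersAt_paramTriple_zero {a : E3} (ha : a ≠ 0) (p : E3) :
    GathersAt paramTriple (a, p, 0, 0) := by
  obtain ⟨e, he⟩ := exists_cross_ne_zero ha
  have hpos := triple_cross_self_pos he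
  set e' := cross a e
  intro U hU
  obtain ⟨r, hr, hrU⟩ := Metric.mem_nhds_iff.1 hU
  obtain ⟨η, hη, hηe, hηe'⟩ : ∃ η : ℝ, 0 < η ∧ η * ‖e‖ < r ∧ η * ‖e'‖ < r := by
    have hs : 0 < ‖e‖ + ‖e'‖ + 1 := by positivity
    refine ⟨r / (‖e‖ + ‖e'‖ + 1), by positivity, ?_, ?_⟩ <;>
    · rw [div_mul_eq_mul_div, div_lt_iff₀ hs]
      nlinarith [norm_nonneg e, norm_nonneg e']
  have hev : ∀ᶠ z : Params in 𝓝 (a, p, 0, 0), z ∈ Metric.ball ((a, p, 0, 0) : Params) r ∧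
      0 < triple e' z.1 e := by
    have hc : Continuous fun z : Params => triple e' z.1 e := by
      simp only [triple_eq]
      fun_prop
    exact Eventually.and (Metric.ball_mem_nhds _ hr) (hc.continuousAt.eventually_const_lt hpos)
  refine ⟨(a, p, η • e', -(η • e)), ?_⟩
  obtain ⟨δ, hδ, hδP⟩ := Metric.eventually_nhds_iff_ball.1 hev
  refine Metric.eventually_nhds_iff_ball.2 ⟨δ, hδ, ?_⟩
  rintro ⟨a₁, p₁, b, d⟩ hz hfz
  obtain ⟨hzr, hω⟩ := hδP _ hz
  -- The sign that makes the mixed term in the first segment nonnegative.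
  obtain ⟨s, hs, hsT⟩ : ∃ s : ℝ, |s| = 1 ∧ 0 ≤ s * (triple e' a₁ b + triple d a₁ e) := by
    rcases le_total 0 (triple e' a₁ b + triple d a₁ e) with h | h
    · exact ⟨1, by simp, by simpa using h⟩
    · exact ⟨-1, by simp, by linarith⟩
  have hss : s * s = 1 := by rw [← abs_mul_abs_self, hs, one_mul]
  have hball : ∀ z ∈ Metric.ball ((a, p, 0, 0) : Params) r, ∀ u v : E3, ‖u‖ < r → ‖v‖ < r →
      ((z.1, z.2.1, u, v) : Params) ∈ Metric.ball ((a, p, 0, 0) : Params) r := by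
    intro z hz u v hu hv
    simp only [Metric.mem_ball, Prod.dist_eq, sup_lt_iff, dist_zero_right] at hz ⊢
    exact ⟨hz.1, hz.2.1, hu, hv⟩
  have hne : ‖η • e‖ < r := by rwa [norm_smul, Real.norm_of_nonneg hη.le]
  have hne' : ‖η • e'‖ < r := by rwa [norm_smul, Real.norm_of_nonneg hη.le]
  have hm₁ : ((a₁, p₁, s • η • e, s • η • e') : Params) ∈
      Metric.ball ((a, p, 0, 0) : Params) r := by
    refine hball _ hzr _ _ ?_ ?_ <;>
    · rw [norm_smul, Real.norm_eq_abs, hs, one_mul]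
      assumption
  have hm₂ : ((a₁, p₁, η • e', -(η • e)) : Params) ∈ Metric.ball ((a, p, 0, 0) : Params) r :=
    hball _ hzr _ _ hne' (by rwa [norm_neg])
  have hm₃ : ((a, p, η • e', -(η • e)) : Params) ∈ Metric.ball ((a, p, 0, 0) : Params) r :=
    hball _ (Metric.mem_ball_self hr) _ _ hne' (by rwa [norm_neg])
  have hsub : ∀ {z z' : Params}, z ∈ Metric.ball ((a, p, 0, 0) : Params) r →
      z' ∈ Metric.ball ((a, p, 0, 0) : Params) r → segment ℝ z z' ⊆ U := fun h h' =>
    ((convex_ball _ r).segment_subset h h').trans hrU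
  refine ⟨(a₁, p₁, s • η • e, s • η • e'), (a₁, p₁, η • e', -(η • e)),
    subset_inter (hsub hzr hm₁) ?_, subset_inter (hsub hm₁ hm₂) ?_,
    subset_inter (hsub hm₂ hm₃) ?_⟩
  · rintro _ ⟨x, y, hx, hy, hxy, rfl⟩
    have ha₁ : x • a₁ + y • a₁ = a₁ := by rw [← add_smul, hxy, one_smul]
    have key : triple (x • d + y • s • η • e') a₁ (x • b + y • s • η • e) =
        x ^ 2 * triple d a₁ b + x * y * η * (s * (triple e' a₁ b + triple d a₁ e)) +
        y ^ 2 * η ^ 2 * (s * s) * triple e' a₁ e := by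
      simp only [triple_eq, PiLp.add_apply, PiLp.smul_apply, smul_eq_mul]
      ring
    change 0 < triple (x • d + y • s • η • e') (x • a₁ + y • a₁) (x • b + y • s • η • e)
    rw [ha₁, key, hss]
    change 0 < triple d a₁ b at hfz
    change 0 < triple e' a₁ e at hω
    rcases hx.eq_or_lt with rfl | hx
    · obtain rfl : y = 1 := by linarith
      positivity
    · positivity
  · rintro _ ⟨x, y, hx, hy, hxy, rfl⟩
    have ha₁ : x • a₁ + y • a₁ = a₁ := by rw [← add_smul, hxy, one_smul]
    have key : triple (x • s • η • e' + y • -(η • e)) a₁ (x • s • η • e + y • η • e') =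
        (x ^ 2 * (s * s) + y ^ 2) * η ^ 2 * triple e' a₁ e := by
      simp only [triple_eq, PiLp.add_apply, PiLp.smul_apply, PiLp.neg_apply, smul_eq_mul]
      ring
    change 0 < triple (x • s • η • e' + y • -(η • e)) (x • a₁ + y • a₁)
      (x • s • η • e + y • η • e')
    rw [ha₁, key, hss]
    change 0 < triple e' a₁ e at hω
    rcases hx.eq_or_lt with rfl | hx
    · obtain rfl : y = 1 := by linarith
      positivity
    · positivity
  · rintro _ ⟨x, y, hx, hy, hxy, rfl⟩
    have key : triple (x • -(η • e) + y • -(η • e)) (x • a₁ + y • a) (x • η • e' + y • η • e') =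
        (x + y) ^ 2 * η ^ 2 * (x * triple e' a₁ e + y * triple e' a e) := by
      simp only [triple_eq, PiLp.add_apply, PiLp.smul_apply, PiLp.neg_apply, smul_eq_mul]
      ring
    change 0 < triple (x • -(η • e) + y • -(η • e)) (x • a₁ + y • a) (x • η • e' + y • η • e')
    rw [key, hxy]
    change 0 < triple e' a₁ e at hω
    rcases hx.eq_or_lt with rfl | hx
    · obtain rfl : y = 1 := by linarith
      positivity
    · positivity

/-- The shear of the parameter space that adds `σ` times the first direction to the second. -/
def shear (σ : ℝ) : Params ≃L[ℝ] Params where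
  toFun z := (z.1, z.2.1, z.2.2.1 + σ • z.1, z.2.2.2)
  invFun z := (z.1, z.2.1, z.2.2.1 - σ • z.1, z.2.2.2)
  map_add' z w := by
    obtain ⟨a, p, b, d⟩ := z
    obtain ⟨a', p', b', d'⟩ := w
    simp only [Prod.mk_add_mk, Prod.mk.injEq, true_and, and_true]
    module
  map_smul' c z := by
    obtain ⟨a, p, b, d⟩ := z
    simp only [Prod.smul_mk, RingHom.id_apply, Prod.mk.injEq, true_and, and_true]
    module
  left_inv z := by simp only [add_sub_cancel_right]
  right_inv z := by simp only [sub_add_cancel]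
  continuous_toFun := by fun_prop
  continuous_invFun := by fun_prop

theorem shear_apply (σ : ℝ) (z : Params) :
    shear σ z = (z.1, z.2.1, z.2.2.1 + σ • z.1, z.2.2.2) := rfl

theorem paramTriple_shear (σ : ℝ) (z : Params) : paramTriple (shear σ z) = paramTriple z := by
  simp only [shear_apply, paramTriple, triple_eq, PiLp.add_apply, PiLp.smul_apply, smul_eq_mul]
  ring

theorem gathersAt_paramTriple {a p b d : E3} (ha : a ≠ 0)
    (h : cross a b ≠ 0 ∨ cross d a ≠ 0 ∨ d = 0 ∧ ∃ σ : ℝ, b = σ • a) :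
    GathersAt paramTriple (a, p, b, d) := by
  rcases h with h | h | ⟨rfl, σ, rfl⟩
  -- The lines are not parallel: move the second one along the common perpendicular.
  · have hg : Continuous fun z : Params => triple (cross a b) z.1 z.2.2.1 := by
      simp only [triple_eq]
      fun_prop
    refine gathersAt_of_affine (N := ((0, 0, 0, cross a b) : Params))
      continuous_paramTriple.continuousAt hg.continuousAt ?_ fun z t => ?_
    · exact triple_cross_self_pos h
    · obtain ⟨a', p', b', d'⟩ := z
      simp only [paramTriple, triple_eq, Prod.mk_add_mk, Prod.smul_mk, smul_zero, add_zero,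
        PiLp.add_apply, PiLp.smul_apply, smul_eq_mul]
      ring
  -- The lines are parallel and distinct: turn the second one in the normal direction of the plane
  -- that contains both.
  · have hg : Continuous fun z : Params => triple (cross d a) z.2.2.2 z.1 := by
      simp only [triple_eq]
      fun_prop
    refine gathersAt_of_affine (N := ((0, 0, cross d a, 0) : Params))
      continuous_paramTriple.continuousAt hg.continuousAt ?_ fun z t => ?_
    · exact triple_cross_self_pos h
    · obtain ⟨a', p', b', d'⟩ := z
      simp only [paramTriple, triple_eq, Prod.mk_add_mk, Prod.smul_mk, smul_zero, add_zero,
        PiLp.add_apply, PiLp.smul_apply, smul_eq_mul]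
      ring
  -- The lines coincide up to orientation.
  · have := (gathersAt_paramTriple_zero ha p).map (shear σ) (paramTriple_shear σ)
    simpa [shear_apply] using this

/-! ### From parameters to lines -/

open Classical in
/-- The oriented line through the point `p` with direction `a`; if `a = 0`, then some line. -/
noncomputable def lineThrough (a p : E3) : OrientedLine :=
  if h : a ≠ 0 then
    ⟨WithLp.toLp 2 (‖a‖⁻¹ • a, p - (inner ℝ a p / ‖a‖ ^ 2) • a), by
      change ‖‖a‖⁻¹ • a‖ = 1
      rw [norm_smul, norm_inv, norm_norm, inv_mul_cancel₀ (norm_ne_zero_iff.2 h)], by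
      change inner ℝ (‖a‖⁻¹ • a) (p - (inner ℝ a p / ‖a‖ ^ 2) • a) = 0
      have : ‖a‖ ≠ 0 := norm_ne_zero_iff.2 h
      rw [inner_smul_left, inner_sub_right, inner_smul_right, real_inner_self_eq_norm_sq,
        div_mul_cancel₀ _ (by positivity), sub_self, mul_zero]⟩
  else ⟨WithLp.toLp 2 (EuclideanSpace.single 0 1, 0), by simp, by simp⟩

theorem coe_lineThrough {a : E3} (h : a ≠ 0) (p : E3) : (lineThrough a p : WithLp 2 (E3 × E3)) =
    WithLp.toLp 2 (‖a‖⁻¹ • a, p - (inner ℝ a p / ‖a‖ ^ 2) • a) := by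
  rw [lineThrough, dif_pos h]

theorem exists_eq_of_mem_carrier_lineThrough {a p x : E3} (h : a ≠ 0)
    (hx : x ∈ (lineThrough a p).carrier) : ∃ t : ℝ, x = p + t • a := by
  obtain ⟨t, rfl⟩ := hx
  refine ⟨t * ‖a‖⁻¹ - inner ℝ a p / ‖a‖ ^ 2, ?_⟩
  rw [OrientedLine.foot, OrientedLine.dir, coe_lineThrough h]
  change p - _ + t • (‖a‖⁻¹ • a) = _
  module

theorem OrientedLine.norm_dir (l : OrientedLine) : ‖l.dir‖ = 1 := l.2.1

theorem OrientedLine.inner_dir_foot (l : OrientedLine) : inner ℝ l.dir l.foot = 0 := l.2.2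

theorem lineThrough_dir_foot (l : OrientedLine) : lineThrough l.dir l.foot = l := by
  refine Subtype.ext ?_
  rw [coe_lineThrough l.dir_ne_zero, l.norm_dir, l.inner_dir_foot]
  simp only [inv_one, one_smul, one_pow, div_one, zero_smul, sub_zero]
  rfl

theorem exists_lipschitzOnWith_lineThrough {E : Type*} [NormedAddCommGroup E] [NormedSpace ℝ E]
    {a p : E → E3} {z₀ : E} (ha : ContDiff ℝ 1 a) (hp : ContDiff ℝ 1 p) (h : a z₀ ≠ 0) :
    ∃ K, ∃ s ∈ 𝓝 z₀, LipschitzOnWith K (fun z => lineThrough (a z) (p z)) s := by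
  have hn : ‖a z₀‖ ≠ 0 := norm_ne_zero_iff.2 h
  have h1 : ContDiffAt ℝ 1 (fun z => ‖a z‖) z₀ := ha.contDiffAt.norm ℝ h
  have h2 : ContDiffAt ℝ 1 (fun z => (‖a z‖⁻¹ • a z,
      p z - (inner ℝ (a z) (p z) / ‖a z‖ ^ 2) • a z)) z₀ :=
    ((h1.inv hn).smul ha.contDiffAt).prodMk (hp.contDiffAt.sub
      (((ha.contDiffAt.inner ℝ hp.contDiffAt).div (h1.pow 2) (pow_ne_zero 2 hn)).smul
        ha.contDiffAt))
  obtain ⟨K, s, hs, hK⟩ := h2.exists_lipschitzOnWith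
  obtain ⟨K', hK'⟩ := Exists.intro (p := fun C => LipschitzOnWith C _ s) _
    ((WithLp.prod_lipschitzWith_toLp 2 E3 E3).comp_lipschitzOnWith hK)
  refine ⟨K', s ∩ {z | a z ≠ 0},
    inter_mem hs (ha.continuous.continuousAt.eventually_ne h), fun z hz w hw => ?_⟩
  rw [Subtype.edist_eq, coe_lineThrough hz.2, coe_lineThrough hw.2]
  exact hK' hz.1 hw.1

/-- The pair of lines with the given parameters, with the direction of the second line multiplied
by `τ`. A sign `τ = -1` exchanges positive and negative triple products. -/
noncomputable def pairThrough (τ : ℝ) (z : Params) : Lines 2 :=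
  WithLp.toLp 2 ![lineThrough z.1 z.2.1, lineThrough (τ • z.2.2.1) (z.2.1 + z.2.2.2)]

theorem exists_lipschitzOnWith_pairThrough {τ : ℝ} (hτ : τ ≠ 0) {z₀ : Params} (ha : z₀.1 ≠ 0)
    (hb : z₀.2.2.1 ≠ 0) : ∃ K, ∃ s ∈ 𝓝 z₀, LipschitzOnWith K (pairThrough τ) s := by
  obtain ⟨K, s, hs, hK⟩ := exists_lipschitzOnWith_lineThrough (a := fun z : Params => z.1)
    (p := fun z : Params => z.2.1) (z₀ := z₀) (by fun_prop) (by fun_prop) ha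
  obtain ⟨K', s', hs', hK'⟩ := exists_lipschitzOnWith_lineThrough
    (a := fun z : Params => τ • z.2.2.1) (p := fun z : Params => z.2.1 + z.2.2.2) (z₀ := z₀)
    (by fun_prop) (by fun_prop) (smul_ne_zero hτ hb)
  have hL : LipschitzOnWith (max K K') (fun z : Params =>
      ![lineThrough z.1 z.2.1, lineThrough (τ • z.2.2.1) (z.2.1 + z.2.2.2)]) (s ∩ s') := by
    intro z hz w hw
    refine edist_pi_le_iff.2 fun i => ?_
    fin_cases i
    · exact (hK hz.1 hw.1).trans (by gcongr; exact le_max_left _ _)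
    · exact (hK' hz.2 hw.2).trans (by gcongr; exact le_max_right _ _)
  exact ⟨_, s ∩ s', inter_mem hs hs',
    (PiLp.lipschitzWith_toLp 2 (fun _ : Fin 2 => OrientedLine)).comp_lipschitzOnWith hL⟩

theorem embedded_iff {c : Lines 2} : Embedded c ↔ Disjoint (c 0).carrier (c 1).carrier := by
  refine ⟨fun h => h 0 1 (by decide), fun h i j hij => ?_⟩
  fin_cases i <;> fin_cases j
  · exact absurd rfl hij
  · exact h
  · exact h.symm
  · exact absurd rfl hij

theorem embedded_pairThrough {τ : ℝ} (hτ : τ ≠ 0) {z : Params} (h : 0 < paramTriple z) :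
    Embedded (pairThrough τ z) := by
  have ha : z.1 ≠ 0 := by
    intro h0
    simp [paramTriple, triple_eq, h0] at h
  have hb : z.2.2.1 ≠ 0 := by
    intro h0
    simp [paramTriple, triple_eq, h0] at h
  refine embedded_iff.2 (Set.disjoint_left.2 fun x hx hx' => h.ne' ?_)
  obtain ⟨s, hs⟩ := exists_eq_of_mem_carrier_lineThrough ha hx
  obtain ⟨t, ht⟩ := exists_eq_of_mem_carrier_lineThrough (smul_ne_zero hτ hb) hx'
  have hd : z.2.2.2 = s • z.1 - t • τ • z.2.2.1 := by
    rw [eq_sub_iff_add_eq, ← add_right_inj z.2.1, ← add_assoc, ← ht, hs]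
  rw [paramTriple, hd]
  simp only [triple_eq, PiLp.sub_apply, PiLp.smul_apply, smul_eq_mul]
  ring

theorem pathEDist_le_of_segment {E : Type*} [NormedAddCommGroup E] [NormedSpace ℝ E] {n : ℕ}
    {ψ : E → Lines n} {K : NNReal} {s : Set E} (hψ : LipschitzOnWith K ψ s) {z w : E}
    (hs : segment ℝ z w ⊆ s) (he : ∀ x ∈ segment ℝ z w, Embedded (ψ x)) :
    pathEDist (ψ z) (ψ w) ≤ K * edist z w := by
  have hm : MapsTo (AffineMap.lineMap z w : ℝ → E) (Icc 0 1) (segment ℝ z w) := by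
    rw [segment_eq_image_lineMap]
    exact mapsTo_image _ _
  have hL : LipschitzWith (nndist z w) (AffineMap.lineMap z w : ℝ → E) :=
    lipschitzWith_lineMap z w
  have hγ : IsEmbPath (ψ z) (ψ w) (ψ ∘ AffineMap.lineMap z w) :=
    ⟨hψ.continuousOn.comp hL.continuous.continuousOn (hm.mono_right hs), by simp, by simp,
      fun t ht => he _ (hm ht)⟩
  refine (iInf_le _ ⟨_, hγ⟩).trans ?_
  refine (hψ.comp_eVariationOn_le (hm.mono_right hs)).trans ?_
  gcongr
  refine ((hL.lipschitzOnWith (s := univ)).comp_eVariationOn_le (f := AffineMap.lineMap z w)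
    (g := id) (s := Icc (0 : ℝ) 1) (mapsTo_univ _ _)).trans ?_
  have := (monotone_id.monotoneOn (Icc (0 : ℝ) 1)).eVariationOn_eq
    (left_mem_Icc.2 zero_le_one) (right_mem_Icc.2 zero_le_one)
  simp only [inter_self, id, sub_zero, ENNReal.ofReal_one] at this
  refine (mul_le_mul_right this.le _).trans ?_
  rw [mul_one, edist_nndist]

/-- If positive values are gathered at `z₀`, then all pairs of lines with positive triple product
and parameters near `z₀` are close in the path metric to a common pair `y`. So are the disjoint
parallel pairs, since turning one of the lines slightly makes the triple product positive. -/
theorem GathersAt.exists_pathEDist_le {z₀ : Params} (h : GathersAt paramTriple z₀)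
    {ψ : Params → Lines 2} {K : NNReal} {s : Set Params} (hs : s ∈ 𝓝 z₀)
    (hψ : LipschitzOnWith K ψ s) (he : ∀ z, 0 < paramTriple z → Embedded (ψ z))
    {ε : ℝ} (hε : 0 < ε) :
    ∃ y, ∀ᶠ z in 𝓝 z₀, (0 < paramTriple z ∨
      (paramTriple z = 0 ∧ cross z.2.2.2 z.1 ≠ 0 ∧ Embedded (ψ z))) →
      pathEDist (ψ z) y ≤ ENNReal.ofReal ε := by
  obtain ⟨r, hr, hrs⟩ := Metric.mem_nhds_iff.1 hs
  -- At most four segments are used, each of length less than `2 * ρ`.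
  obtain ⟨ρ, hρ, hρr, hρε⟩ : ∃ ρ : ℝ, 0 < ρ ∧ ρ ≤ r ∧ K * (2 * ρ) * 4 ≤ ε := by
    refine ⟨min r (ε / (8 * (K + 1))), by positivity, min_le_left _ _, ?_⟩
    have h1 : min r (ε / (8 * (K + 1))) ≤ ε / (8 * (K + 1)) := min_le_right _ _
    have h2 := (le_div_iff₀ (by positivity)).1 h1
    have h3 : 0 < min r (ε / (8 * (K + 1))) := by positivity
    nlinarith
  set B := Metric.ball z₀ ρ
  have hstep : ∀ z w, segment ℝ z w ⊆ B → (∀ x ∈ segment ℝ z w, Embedded (ψ x)) →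
      pathEDist (ψ z) (ψ w) ≤ ENNReal.ofReal (K * (2 * ρ)) := by
    intro z w hzw hemb
    refine (pathEDist_le_of_segment hψ (hzw.trans ((Metric.ball_subset_ball hρr).trans hrs))
      hemb).trans ?_
    rw [ENNReal.ofReal_mul NNReal.zero_le_coe, edist_dist, ENNReal.ofReal_coe_nnreal]
    gcongr
    have h1 : dist z z₀ < ρ := hzw (left_mem_segment ℝ z w)
    have h2 : dist w z₀ < ρ := hzw (right_mem_segment ℝ z w)
    linarith [dist_triangle_right z w z₀]
  obtain ⟨y, hy⟩ := h B (Metric.ball_mem_nhds z₀ hρ)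
  have hpos : ∀ᶠ z in 𝓝 z₀, 0 < paramTriple z →
      pathEDist (ψ z) (ψ y) ≤ ENNReal.ofReal (K * (2 * ρ) * 3) := by
    refine hy.mono fun z hz hfz => ?_
    obtain ⟨z₁, z₂, h1, h2, h3⟩ := hz hfz
    have hst : ∀ {z w}, segment ℝ z w ⊆ B ∩ {w | 0 < paramTriple w} →
        pathEDist (ψ z) (ψ w) ≤ ENNReal.ofReal (K * (2 * ρ)) := fun h =>
      hstep _ _ (h.trans inter_subset_left) fun x hx => he x (h hx).2
    refine (pathEDist_triangle _ (ψ z₂) _).trans ((add_le_add_left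
      (pathEDist_triangle _ (ψ z₁) _) _).trans ((add_le_add (add_le_add (hst h1) (hst h2))
      (hst h3)).trans ?_))
    rw [← ENNReal.ofReal_add (by positivity) (by positivity),
      ← ENNReal.ofReal_add (by positivity) (by positivity)]
    exact ENNReal.ofReal_le_ofReal (by linarith)
  obtain ⟨δ, hδ, hδP⟩ := Metric.eventually_nhds_iff_ball.1
    (Eventually.and (Metric.ball_mem_nhds z₀ hρ) hpos)
  refine ⟨ψ y, Metric.eventually_nhds_iff_ball.2 ⟨δ, hδ, fun z hz hfz => ?_⟩⟩
  have hKρ : (0 : ℝ) ≤ K * (2 * ρ) := by positivity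
  rcases hfz with hfz | ⟨hfz, hd, hemb⟩
  · exact ((hδP z hz).2 hfz).trans (ENNReal.ofReal_le_ofReal (by linarith))
  have hline : ∀ t : ℝ, paramTriple (z + t • ((0, 0, cross z.2.2.2 z.1, 0) : Params)) =
      t * triple (cross z.2.2.2 z.1) z.2.2.2 z.1 := by
    intro t
    -- `hfz` supplies the constant term, since `paramTriple z = 0`.
    rw [← add_zero (t * _), ← hfz]
    obtain ⟨a, p, b, d⟩ := z
    simp only [paramTriple, triple_eq, Prod.mk_add_mk, Prod.smul_mk, smul_zero, add_zero,
      PiLp.add_apply, PiLp.smul_apply, smul_eq_mul]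
    ring
  set N : Params := (0, 0, cross z.2.2.2 z.1, 0)
  have hN := triple_cross_self_pos hd
  obtain ⟨t, ht, ht'⟩ : ∃ t : ℝ, 0 < t ∧ z + t • N ∈ Metric.ball z₀ δ := by
    have hc : Tendsto (fun t : ℝ => z + t • N) (𝓝[>] 0) (𝓝 z) := by
      have : Continuous fun t : ℝ => z + t • N := by fun_prop
      simpa using (this.tendsto 0).mono_left nhdsWithin_le_nhds
    obtain ⟨t, h1, h2⟩ := ((hc.eventually (Metric.isOpen_ball.mem_nhds hz)).and
      self_mem_nhdsWithin).exists
    exact ⟨t, h2, h1⟩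
  have hfirst : pathEDist (ψ z) (ψ (z + t • N)) ≤ ENNReal.ofReal (K * (2 * ρ)) := by
    refine hstep _ _ ((convex_ball _ _).segment_subset (hδP _ hz).1 (hδP _ ht').1) ?_
    rintro _ ⟨u, v, hu, hv, huv, rfl⟩
    have hx : u • z + v • (z + t • N) = z + (v * t) • N := by
      rw [smul_add, ← add_assoc, ← add_smul, huv, one_smul, smul_smul]
    rw [hx]
    rcases hv.eq_or_lt with rfl | hv
    · simpa using hemb
    · refine he _ ?_
      rw [hline]
      positivity
  have hsecond := (hδP _ ht').2 (by rw [hline]; positivity)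
  refine (pathEDist_triangle _ _ _).trans ((add_le_add hfirst hsecond).trans ?_)
  rw [← ENNReal.ofReal_add (by positivity) (by positivity)]
  exact ENNReal.ofReal_le_ofReal (by linarith)

/-- Parameters of a pair of lines from which `pairThrough τ` recovers the pair, if `τ = ± 1`. -/
def toParams (τ : ℝ) (c : Lines 2) : Params :=
  ((c 0).dir, (c 0).foot, τ • (c 1).dir, (c 1).foot - (c 0).foot)

theorem continuous_toParams (τ : ℝ) : Continuous (toParams τ) := by
  have hd : Continuous OrientedLine.dir := by unfold OrientedLine.dir; fun_prop
  have hf : Continuous OrientedLine.foot := by unfold OrientedLine.foot; fun_prop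
  have h0 : Continuous fun c : Lines 2 => c 0 := by fun_prop
  have h1 : Continuous fun c : Lines 2 => c 1 := by fun_prop
  exact (hd.comp h0).prodMk ((hf.comp h0).prodMk (((hd.comp h1).const_smul τ).prodMk
    ((hf.comp h1).sub (hf.comp h0))))

theorem pairThrough_toParams {τ : ℝ} (hτ : τ * τ = 1) (c : Lines 2) :
    pairThrough τ (toParams τ c) = c := by
  refine WithLp.ofLp_injective 2 (funext fun i => ?_)
  fin_cases i
  · exact lineThrough_dir_foot (c 0)
  · change lineThrough (τ • τ • (c 1).dir) ((c 0).foot + ((c 1).foot - (c 0).foot)) = c 1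
    rw [smul_smul, hτ, one_smul, add_sub_cancel, lineThrough_dir_foot]

theorem paramTriple_toParams (τ : ℝ) (c : Lines 2) :
    paramTriple (toParams τ c) = τ * lineTriple (c 0) (c 1) := by
  simp only [paramTriple, toParams, lineTriple, triple_eq, PiLp.smul_apply, smul_eq_mul]
  ring

theorem cross_comm_eq_zero {a b : E3} : cross a b = 0 ↔ cross b a = 0 := by
  simp only [cross_eq_zero_iff]
  constructor <;> rintro ⟨h0, h1, h2⟩ <;> refine ⟨?_, ?_, ?_⟩ <;> linarith

theorem gathersAt_toParams {τ : ℝ} (hτ : τ ≠ 0) (x : Lines 2) :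
    GathersAt paramTriple (toParams τ x) := by
  refine gathersAt_paramTriple (x 0).dir_ne_zero ?_
  by_contra! h
  obtain ⟨h1, h2, h3⟩ := h
  obtain ⟨r, hr⟩ := exists_eq_smul_of_cross_eq_zero (x 0).dir_ne_zero h1
  obtain ⟨q, hq⟩ := exists_eq_smul_of_cross_eq_zero (x 0).dir_ne_zero (cross_comm_eq_zero.1 h2)
  refine h3 ?_ r hr
  -- Both feet are orthogonal to the common direction of the parallel lines.
  have hr0 : r ≠ 0 := by
    rintro rfl
    rw [zero_smul] at hr
    exact smul_ne_zero hτ (x 1).dir_ne_zero hr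
  have h4 : inner ℝ (x 0).dir (x 1).foot = 0 := by
    have h5 : inner ℝ (τ • (x 1).dir) (x 1).foot = 0 := by
      rw [inner_smul_left, (x 1).inner_dir_foot, mul_zero]
    rw [hr, inner_smul_left] at h5
    exact (mul_eq_zero.1 h5).resolve_left (by simpa using hr0)
  have h6 : inner ℝ (x 0).dir ((x 1).foot - (x 0).foot) = 0 := by
    rw [inner_sub_right, h4, (x 0).inner_dir_foot, sub_zero]
  rw [hq, inner_smul_right, real_inner_self_eq_norm_sq, (x 0).norm_dir, one_pow, mul_one] at h6
  rw [hq, h6, zero_smul]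

/-- Pairs of disjoint lines near `x` whose triple product has the sign `τ`, or which are parallel,
are close in the path metric to a common pair of lines. -/
theorem exists_pathEDist_le {τ : ℝ} (hτ : τ * τ = 1) (x : Lines 2) {ε : ℝ} (hε : 0 < ε) :
    ∃ y, ∀ᶠ c in 𝓝 x, Embedded c →
      (0 < τ * lineTriple (c 0) (c 1) ∨ cross (c 0).dir (c 1).dir = 0) →
      pathEDist c y ≤ ENNReal.ofReal ε := by
  have hτ0 : τ ≠ 0 := left_ne_zero_of_mul_eq_one hτ
  obtain ⟨K, s, hs, hK⟩ := exists_lipschitzOnWith_pairThrough hτ0 (z₀ := toParams τ x)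
    (x 0).dir_ne_zero (smul_ne_zero hτ0 (x 1).dir_ne_zero)
  obtain ⟨y, hy⟩ := (gathersAt_toParams hτ0 x).exists_pathEDist_le hs hK
    (fun z => embedded_pairThrough hτ0) hε
  refine ⟨y, (((continuous_toParams τ).tendsto x).eventually hy).mono fun c hc he h => ?_⟩
  rw [pairThrough_toParams hτ, paramTriple_toParams] at hc
  refine hc (h.imp id fun hp => ⟨?_, cross_foot_sub_foot_ne_zero (embedded_iff.1 he), he⟩)
  obtain ⟨e0, e1, e2⟩ := cross_eq_zero_iff.1 hp
  rw [lineTriple, triple_eq, e0, e1, e2]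
  ring

theorem dist_lt_of_pathEDist_le {n : ℕ} {c c' : Conf n} {y : Lines n} {ε : ℝ} (hε : 0 < ε)
    (h : pathEDist c.lines y ≤ ENNReal.ofReal (ε / 3))
    (h' : pathEDist c'.lines y ≤ ENNReal.ofReal (ε / 3)) : dist c c' < ε := by
  have h1 : pathEDist c.lines c'.lines ≤ ENNReal.ofReal (2 * (ε / 3)) := by
    refine (pathEDist_triangle _ y _).trans ?_
    rw [pathEDist_comm y, two_mul, ENNReal.ofReal_add (by positivity) (by positivity)]
    exact add_le_add h h'
  calc dist c c' = (min (pathEDist c.lines c'.lines) 1).toReal := rfl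
    _ ≤ 2 * (ε / 3) := ENNReal.toReal_le_of_le_ofReal (by positivity) ((min_le_left _ _).trans h1)
    _ < ε := by linarith

theorem equalLabelsClose_two : EqualLabelsClose 2 := by
  intro x α ε hε
  -- One pair for each sign; parallel pairs are close to either of them.
  obtain ⟨y, hy⟩ := exists_pathEDist_le (τ := 1) (by norm_num) x (ε := ε / 3) (by positivity)
  obtain ⟨y', hy'⟩ := exists_pathEDist_le (τ := -1) (by norm_num) x (ε := ε / 3) (by positivity)
  obtain ⟨δ, hδ, h⟩ := Metric.eventually_nhds_iff.1 (hy.and hy')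
  refine ⟨δ, hδ, fun c c' hc hc' hcx hcx' => ?_⟩
  obtain ⟨h1, h2⟩ := h hcx
  obtain ⟨h1', h2'⟩ := h hcx'
  replace h1 := h1 c.embedded
  replace h2 := h2 c.embedded
  replace h1' := h1' c'.embedded
  replace h2' := h2' c'.embedded
  have hlab : linkingNumber (c.lines 0) (c.lines 1) = linkingNumber (c'.lines 0) (c'.lines 1) :=
    congrFun (hc.trans hc'.symm) ⟨(0, 1), by decide⟩
  rcases linkingNumber_cases (embedded_iff.1 c.embedded) with
    ⟨hl, hp⟩ | ⟨hl, hp⟩ | ⟨hl, hp⟩ <;>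
  rcases linkingNumber_cases (embedded_iff.1 c'.embedded) with
    ⟨hl', hp'⟩ | ⟨hl', hp'⟩ | ⟨hl', hp'⟩ <;>
  first
  | exact absurd (hl.symm.trans (hlab.trans hl')) (by decide)
  | skip
  · exact dist_lt_of_pathEDist_le hε (h1 (.inl (by rwa [one_mul]))) (h1' (.inl (by rwa [one_mul])))
  · exact dist_lt_of_pathEDist_le hε (h2 (.inl (by linarith))) (h2' (.inl (by linarith)))
  · exact dist_lt_of_pathEDist_le hε (h1 (.inr hp)) (h1' (.inr hp'))

end TwoLines

theorem mainTheorem3 :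
    ∃ h : TwoLines.CompletedConf 2 ≃ₜ TwoLines.BlowUp 2,
      ∀ p : TwoLines.CompletedConf 2,
        (h p : TwoLines.QuotLabelled 2) = TwoLines.PhiTilde p :=
  TwoLines.equalLabelsClose_two.exists_homeomorph
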